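/- Let $L$ be a first-order language and let $T$ be an $L$-theory (a set of $L$-sentences). An element $m$ of an $L$-structure $\mathcal{M}$ is *algebraic* in $\mathcal{M}$ if there is an $L$-formula $\varphi(x)$ without parameters, in one free variable, such that $\{a\in M : \mathcal{M}\models\varphi(a)\}$ is finite and contains $m$. A structure is *algebraic* if all of its elements are algebraic in it, and *nonalgebraic* otherwise. An automorphism of $\mathcal{M}$ is *maximal* if it moves every nonalgebraic element of $\mathcal{M}$. Suppose that $T$ has an infinite algebraic model. Then for every cardinal $\kappa\geq\max\{\aleph_0,|L|\}$, where $|L|$ is the number of non-logical symbols of $L$, the theory $T$ has a nonalgebraic model $\mathcal{N}$ of cardinality $\kappa$ that carries an automorphism $\alpha$ such that $\alpha^n$ is a maximal automorphism of $\mathcal{N}$ for every integer $n\geq 1$. -/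

import Mathlib

universe u v w w'

open FirstOrder
open scoped FirstOrder Cardinal

namespace AlgModel

variable (L : FirstOrder.Language) {M : Type*} [L.Structure M]

/-- An element `m` of the structure `M` is algebraic in `M` if some parameter-free `L`-formula
`φ(x)` in one free variable defines a finite subset of `M` that contains `m`. -/
def IsAlgebraicElement (m : M) : Prop :=
  ∃ φ : L.Formula (Fin 1),
    {x : M | φ.Realize (fun _ => x)}.Finite ∧ φ.Realize (fun _ => m)

variable (M) in
/-- A structure is algebraic if each of its elements is algebraic in it. -/
def IsAlgebraicStructure : Prop :=
  ∀ m : M, IsAlgebraicElement L m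

variable {L}

/-- An automorphism of `M` is maximal if it moves every nonalgebraic element of `M`. -/
def IsMaximalAutomorphism (α : M ≃[L] M) : Prop :=
  ∀ m : M, ¬ IsAlgebraicElement L m → α m ≠ m

/-- The `n`-fold composition of an automorphism with itself. -/
def iterateAut (α : M ≃[L] M) : ℕ → (M ≃[L] M)
  | 0 => FirstOrder.Language.Equiv.refl L M
  | n + 1 => α.comp (iterateAut α n)

theorem coe_iterateAut (α : M ≃[L] M) (n : ℕ) : ⇑(iterateAut α n) = (⇑α)^[n] := by
  induction n with
  | zero => rfl
  | succ n ih =>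
    funext x
    rw [Function.iterate_succ_apply', ← ih]
    rfl

end AlgModel

-- Let `M` be the infinite algebraic model and `U` a nonprincipal ultrafilter on it. Iterate the
-- ultrapower of `M` along `I = ℤ ×ₗ ι` with `#ι = κ`: its elements are classes of functions `(I →
-- M) → M` depending on finitely many coordinates. Order automorphisms of `I` act on it, and
-- translation of `ℤ` by `1` gives an automorphism σ.
--
-- If σ^n fixes the class of `f`, so does some power of σ^n that moves the support of `f` entirely
-- above itself. A function almost everywhere equal to a copy of itself in later coordinates is
-- almost everywhere constant (`exists_eventually_eq_const`). The constant lies in `M`, so it is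
-- algebraic, and by Łoś so is its class (`isAlgebraicElement_finiteGerm`). Coordinate projections
-- have infinite orbits, hence are nonalgebraic. Löwenheim–Skolem in the language with σ and σ⁻¹
-- added cuts the cardinality down to κ.

universe x

/-! ### Iterated ultrafilter quantifiers. -/

namespace IteratedUltrafilter

open Filter Function

variable {I : Type*} {M : Type*} (U : Ultrafilter M)

section Coordinates

variable [DecidableEq I]

/-- `P` holds for `U`-almost all values of the coordinate `i`. -/
def CoordEventually (i : I) (P : (I → M) → Prop) (x : I → M) : Prop :=
  ∀ᶠ m in (U : Filter M), P (update x i m)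

/-- The quantifiers "for `U`-almost all values of the coordinate `i`", iterated along a list of
coordinates; the head of the list is the outermost quantifier. -/
def IterEventually (l : List I) (P : (I → M) → Prop) : (I → M) → Prop :=
  l.foldr (CoordEventually U) P

theorem iterEventually_cons (i : I) (l : List I) (P : (I → M) → Prop) :
    IterEventually U (i :: l) P = CoordEventually U i (IterEventually U l P) := rfl

theorem iterEventually_append (l l' : List I) (P : (I → M) → Prop) :
    IterEventually U (l ++ l') P = IterEventually U l (IterEventually U l' P) :=
  List.foldr_append

theorem iterEventually_mono (l : List I) {P P' : (I → M) → Prop} (h : ∀ x, P x → P' x) :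
    ∀ x, IterEventually U l P x → IterEventually U l P' x := by
  induction l with
  | nil => exact h
  | cons i l ih => exact fun x hx => hx.mono fun m hm => ih _ hm

theorem iterEventually_const (l : List I) (p : Prop) (x : I → M) :
    IterEventually U l (fun _ => p) x ↔ p := by
  induction l generalizing x with
  | nil => rfl
  | cons i l ih =>
    rw [iterEventually_cons]
    simp only [CoordEventually, ih, eventually_const]

theorem iterEventually_and (l : List I) (P P' : (I → M) → Prop) (x : I → M) :
    IterEventually U l (fun x => P x ∧ P' x) x ↔
      IterEventually U l P x ∧ IterEventually U l P' x := by
  induction l generalizing x with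
  | nil => rfl
  | cons i l ih =>
    simp only [iterEventually_cons, CoordEventually, ih, eventually_and]

theorem iterEventually_not (l : List I) (P : (I → M) → Prop) (x : I → M) :
    IterEventually U l (fun x => ¬ P x) x ↔ ¬ IterEventually U l P x := by
  induction l generalizing x with
  | nil => rfl
  | cons i l ih =>
    simp only [iterEventually_cons, CoordEventually, ih, Ultrafilter.eventually_not]

/-- The value at `x` only involves points that agree with `x` off the quantified coordinates. -/
theorem iterEventually_congr (l : List I) (P P' : (I → M) → Prop) (x : I → M)
    (h : ∀ y, (∀ i ∉ l, y i = x i) → (P y ↔ P' y)) :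
    IterEventually U l P x ↔ IterEventually U l P' x := by
  induction l generalizing x with
  | nil => exact h x fun _ _ => rfl
  | cons i l ih =>
    simp only [iterEventually_cons, CoordEventually]
    refine eventually_congr (Eventually.of_forall fun m => ih _ fun y hy => h y fun j hj => ?_)
    rw [List.mem_cons, not_or] at hj
    rw [hy j hj.2, update_of_ne hj.1]

theorem dependsOn_iterEventually {P : (I → M) → Prop} {s : Set I} (hP : DependsOn P s)
    (l : List I) : DependsOn (IterEventually U l P) (s \ {i | i ∈ l}) := by
  induction l with
  | nil => exact hP.mono fun i hi => ⟨hi, by simp⟩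
  | cons i l ih =>
    intro x y hxy
    simp only [iterEventually_cons, CoordEventually]
    congr! 2 with m
    refine propext_iff.1 (ih fun j hj => ?_)
    by_cases hji : j = i
    · subst hji; simp
    · rw [update_of_ne hji, update_of_ne hji]
      exact hxy j ⟨hj.1, by simpa [hji] using hj.2⟩

theorem coordEventually_of_notMem {P : (I → M) → Prop} {s : Set I} (hP : DependsOn P s) {i : I}
    (hi : i ∉ s) : CoordEventually U i P = P := by
  funext x
  have : ∀ m, P (update x i m) = P x := fun m => hP fun j hj => by
    exact update_of_ne (ne_of_mem_of_not_mem hj hi) _ _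
  simp only [CoordEventually, this, eventually_const]

/-- Quantifiers over coordinates outside the support are vacuous. This makes iteration along
different finite sets containing the support agree. -/
theorem iterEventually_filter {P : (I → M) → Prop} (s : Finset I) (hP : DependsOn P (s : Set I))
    (l : List I) : IterEventually U l P = IterEventually U (l.filter (· ∈ s)) P := by
  induction l with
  | nil => rfl
  | cons i l ih =>
    rw [iterEventually_cons, ih]
    by_cases hi : i ∈ s
    · rw [List.filter_cons_of_pos (by simpa using hi), iterEventually_cons]
    · rw [List.filter_cons_of_neg (by simpa using hi)]
      exact coordEventually_of_notMem U (dependsOn_iterEventually U hP _) fun h => hi h.1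

theorem iterEventually_comp (τ : I ≃ I) (l : List I) (P : (I → M) → Prop) (x : I → M) :
    IterEventually U (l.map τ) (fun x => P (x ∘ τ)) x ↔ IterEventually U l P (x ∘ τ) := by
  induction l generalizing x with
  | nil => rfl
  | cons i l ih =>
    simp only [List.map_cons, iterEventually_cons, CoordEventually, ih]
    have : ∀ m, update x (τ i) m ∘ τ = update (x ∘ τ) i m := fun m =>
      update_comp_eq_of_injective x τ.injective i m
    simp only [this]

end Coordinates

/-- A function depends on finitely many coordinates only. -/
def FiniteSupport {β : Type*} (f : (I → M) → β) : Prop :=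
  ∃ s : Finset I, DependsOn f (s : Set I)

theorem finiteSupport_eval (i : I) : FiniteSupport fun y : I → M => y i :=
  ⟨{i}, fun _ _ h => h i (by simp)⟩

theorem FiniteSupport.exists_common {ι β : Type*} [Finite ι] {f : ι → (I → M) → β}
    (hf : ∀ k, FiniteSupport (f k)) : ∃ s : Finset I, ∀ k, DependsOn (f k) (s : Set I) := by
  classical
  have := Fintype.ofFinite ι
  choose s hs using hf
  exact ⟨Finset.univ.biUnion s, fun k => (hs k).mono (by
    exact_mod_cast Finset.subset_biUnion_of_mem s (Finset.mem_univ k))⟩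

theorem FiniteSupport.comp_tuple {ι β γ : Type*} [Finite ι] {f : ι → (I → M) → β}
    (hf : ∀ k, FiniteSupport (f k)) (g : (ι → β) → γ) :
    FiniteSupport fun x => g fun k => f k x := by
  obtain ⟨s, hs⟩ := FiniteSupport.exists_common hf
  exact ⟨s, fun x y hxy => congrArg g (funext fun k => hs k hxy)⟩

/-! ### The product ultrafilter over a linearly ordered index set. -/

variable [LinearOrder I]

theorem filter_sort_of_subset {s t : Finset I} (h : s ⊆ t) :
    (t.sort (· ≤ ·)).filter (· ∈ s) = s.sort (· ≤ ·) := by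
  refine List.Perm.eq_of_pairwise' (r := (· ≤ ·)) ((t.pairwise_sort _).filter _)
    (s.pairwise_sort _) ?_
  rw [List.perm_ext_iff_of_nodup ((t.sort_nodup _).filter _) (s.sort_nodup _)]
  intro a
  simpa using fun ha => h ha

theorem iterEventually_sort {P : (I → M) → Prop} {s t : Finset I} (hP : DependsOn P (s : Set I))
    (h : s ⊆ t) :
    IterEventually U (t.sort (· ≤ ·)) P = IterEventually U (s.sort (· ≤ ·)) P := by
  rw [iterEventually_filter U s hP, filter_sort_of_subset h]

theorem iterEventually_sort_const {P : (I → M) → Prop} {s : Finset I}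
    (hP : DependsOn P (s : Set I)) (x y : I → M) :
    IterEventually U (s.sort (· ≤ ·)) P x ↔ IterEventually U (s.sort (· ≤ ·)) P y :=
  iff_of_eq (dependsOn_iterEventually U hP _ fun i hi => absurd hi.1 (by simpa using hi.2))

variable (I) in
/-- The filter of sets that are iteratively `U`-large along all large finite sets of
coordinates. -/
def productFilter : Filter (I → M) where
  sets := {B | ∀ᶠ t : Finset I in atTop, ∀ x, IterEventually U (t.sort (· ≤ ·)) (· ∈ B) x}
  univ_sets := Eventually.of_forall fun _ x => (iterEventually_const U _ True x).2 trivial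
  sets_of_superset h hB := h.mono fun _ ht x => iterEventually_mono U _ (fun _ hx => hB hx) _ (ht x)
  inter_sets h h' := (h.and h').mono fun _ ht x =>
    (iterEventually_and U _ _ _ x).2 ⟨ht.1 x, ht.2 x⟩

instance [Nonempty M] : (productFilter I U).NeBot := by
  refine ⟨fun h => ?_⟩
  have h' : (∅ : Set (I → M)) ∈ productFilter I U := h ▸ mem_bot
  obtain ⟨t, ht⟩ := Eventually.exists (f := atTop) h'
  exact (iterEventually_const U _ False (Classical.arbitrary _)).1 (ht _)

variable (I) in
/-- An ultrafilter on `I → M` that extends the iterated product of `U` along `I`. -/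
noncomputable def productUltrafilter [Nonempty M] : Ultrafilter (I → M) :=
  Ultrafilter.of (productFilter I U)

/-- Iterated quantifiers commute with negation, so the filter already decides every predicate of
finite support; the arbitrary choice of an extending ultrafilter is invisible to them. -/
theorem eventually_productUltrafilter [Nonempty M] {P : (I → M) → Prop} {s : Finset I}
    (hP : DependsOn P (s : Set I)) (x : I → M) :
    (∀ᶠ y in (productUltrafilter I U : Filter (I → M)), P y) ↔
      IterEventually U (s.sort (· ≤ ·)) P x := by
  have key : ∀ {P : (I → M) → Prop}, DependsOn P (s : Set I) →
      IterEventually U (s.sort (· ≤ ·)) P x →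
      ∀ᶠ y in (productUltrafilter I U : Filter (I → M)), P y := by
    intro P hP hx
    refine Ultrafilter.of_le (productFilter I U) ?_
    refine (eventually_ge_atTop s).mono fun t ht y => ?_
    change IterEventually U _ P y
    rw [iterEventually_sort U hP ht]
    exact (iterEventually_sort_const U hP y x).2 hx
  refine ⟨fun h => ?_, key hP⟩
  by_contra hx
  have h' := key (P := fun x => ¬ P x) (fun y z hyz => congrArg Not (hP hyz))
    ((iterEventually_not U _ P x).2 hx)
  exact (Ultrafilter.eventually_not.1 h') h

theorem dependsOn_comp_orderIso {β : Type*} {f : (I → M) → β} {s : Finset I}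
    (hf : DependsOn f (s : Set I)) (τ : I ≃o I) :
    DependsOn (fun x => f (x ∘ τ)) (s.map τ.toEquiv.toEmbedding : Set I) := fun x y hxy =>
  hf fun i hi => hxy (τ i) (by simpa using hi)

theorem FiniteSupport.comp_orderIso {β : Type*} {f : (I → M) → β} (hf : FiniteSupport f)
    (τ : I ≃o I) : FiniteSupport fun x => f (x ∘ τ) :=
  hf.elim fun _ hs => ⟨_, dependsOn_comp_orderIso hs τ⟩

theorem sort_map (s : Finset I) (τ : I ≃o I) :
    (s.map τ.toEquiv.toEmbedding).sort (· ≤ ·) = (s.sort (· ≤ ·)).map τ := by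
  refine (Finset.map_sort (r := (· ≤ ·)) (r' := (· ≤ ·)) τ.toEquiv.toEmbedding s ?_).symm
  intro a _ b _
  exact (τ.le_iff_le).symm

/-- On predicates of finite support, the ultrafilter is invariant under automorphisms of the
index order. -/
theorem eventually_comp_orderIso [Nonempty M] {P : (I → M) → Prop} {s : Finset I}
    (hP : DependsOn P (s : Set I)) (τ : I ≃o I) :
    (∀ᶠ y in (productUltrafilter I U : Filter (I → M)), P (y ∘ τ)) ↔
      ∀ᶠ y in (productUltrafilter I U : Filter (I → M)), P y := by
  have x : I → M := Classical.arbitrary _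
  rw [eventually_productUltrafilter U hP (x ∘ τ),
    eventually_productUltrafilter U (dependsOn_comp_orderIso hP τ) x, sort_map]
  exact iterEventually_comp U τ.toEquiv _ P x

theorem sort_union_of_lt {s t : Finset I} (h : ∀ i ∈ s, ∀ j ∈ t, i < j) :
    (s ∪ t).sort (· ≤ ·) = s.sort (· ≤ ·) ++ t.sort (· ≤ ·) := by
  have hd : (s.sort (· ≤ ·) ++ t.sort (· ≤ ·)).Nodup :=
    (s.sort_nodup _).append (t.sort_nodup _) fun i hi hj =>
      lt_irrefl i (h i (by simpa using hi) i (by simpa using hj))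
  refine List.Perm.eq_of_pairwise' (r := (· ≤ ·)) (Finset.pairwise_sort _ _)
    (List.pairwise_append.2 ⟨s.pairwise_sort _, t.pairwise_sort _, fun i hi j hj =>
      (h i (by simpa using hi) j (by simpa using hj)).le⟩) ?_
  rw [List.perm_ext_iff_of_nodup (Finset.sort_nodup _ _) hd]
  intro a
  simp

/-- A function of finite support that is almost everywhere equal to its translate along an
automorphism moving the support past itself is almost everywhere constant. -/
theorem exists_eventually_eq_const [Nonempty M] {β : Type*} {f : (I → M) → β} {s : Finset I}
    (hf : DependsOn f (s : Set I)) (τ : I ≃o I) (hτ : ∀ i ∈ s, ∀ j ∈ s, i < τ j)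
    (h : ∀ᶠ y in (productUltrafilter I U : Filter (I → M)), f y = f (y ∘ τ)) :
    ∃ x, ∀ᶠ y in (productUltrafilter I U : Filter (I → M)), f y = f x := by
  set t := s.map τ.toEquiv.toEmbedding with ht
  have hft : DependsOn (fun y => f (y ∘ τ)) (t : Set I) := dependsOn_comp_orderIso hf τ
  have hst : ∀ i ∈ s, ∀ j ∈ t, i < j := by
    intro i hi j hj
    obtain ⟨k, hk, rfl⟩ := Finset.mem_map.1 hj
    exact hτ i hi k hk
  have hdep : DependsOn (fun y => f y = f (y ∘ τ)) ((s ∪ t : Finset I) : Set I) := by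
    intro x y hxy
    have h₁ : f x = f y := hf fun i hi => hxy i (by simp at hi; simp [hi])
    have h₂ : f (x ∘ τ) = f (y ∘ τ) := hft fun i hi => hxy i (by simp at hi; simp [hi])
    simp only [h₁, h₂]
  have x₀ : I → M := Classical.arbitrary _
  rw [eventually_productUltrafilter U hdep x₀, sort_union_of_lt hst, iterEventually_append] at h
  -- The outer quantifiers run over `s`, the inner ones over `t`; pick one point at which the inner
  -- statement holds.
  obtain ⟨x, hx⟩ : ∃ x, IterEventually U (t.sort (· ≤ ·)) (fun y => f y = f (y ∘ τ)) x := by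
    by_contra hne
    push Not at hne
    exact (iterEventually_const U _ False x₀).1 (iterEventually_mono U _ (fun x hx => hne x hx) _ h)
  refine ⟨x, ?_⟩
  have hconst : DependsOn (fun y => f y = f x) (s : Set I) := fun y z hyz => by
    simp only [hf hyz]
  rw [← eventually_comp_orderIso U hconst τ,
    eventually_productUltrafilter U (dependsOn_comp_orderIso hconst τ) x]
  -- The inner quantifiers leave the coordinates in `s` untouched, so `f y` is frozen at `f x`.
  refine (iterEventually_congr U _ _ _ x fun y hy => ?_).1 hx
  have hyx : f y = f x := hf fun i hi => hy i fun hit =>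
    lt_irrefl i (hst i hi i ((Finset.mem_sort _).1 hit))
  rw [hyx]
  exact eq_comm

/-- The coordinate `i` is quantified first; once its value is fixed, nonprincipality makes almost
every value of `j` differ from it. -/
theorem eventually_ne_of_lt [Nonempty M] (hU : ∀ m, ∀ᶠ m' in (U : Filter M), m' ≠ m) {i j : I}
    (hij : i < j) :
    ∀ᶠ y in (productUltrafilter I U : Filter (I → M)), y i ≠ y j := by
  have hdep : DependsOn (fun y : I → M => y i ≠ y j) (({i} ∪ {j} : Finset I) : Set I) := by
    intro x y hxy
    simp only [hxy i (by simp), hxy j (by simp)]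
  rw [eventually_productUltrafilter U hdep (Classical.arbitrary _),
    sort_union_of_lt (by simpa using hij)]
  simp only [Finset.sort_singleton, List.cons_append, List.nil_append, iterEventually_cons,
    CoordEventually]
  refine Eventually.of_forall fun m => (hU m).mono fun m' hm => ?_
  simpa [IterEventually, update_of_ne hij.ne] using hm.symm

end IteratedUltrafilter

/-! ### The iterated ultrapower and its shift automorphisms. -/

namespace IteratedUltrafilter

open Filter Function FirstOrder.Language

variable {L : FirstOrder.Language.{u, v}} {I : Type w} [LinearOrder I] {M : Type w'} [Nonempty M]
  [L.Structure M] (U : Ultrafilter M)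

variable (I) in
/-- The ultrapower of `M` by the iterated product of `U` along `I`. -/
abbrev Power : Type (max w w') :=
  (productUltrafilter I U : Filter (I → M)).Product fun _ => M

/-- The class of a function in the ultrapower. -/
noncomputable def germ (f : (I → M) → M) : Power I U :=
  Quotient.mk' (s := (productUltrafilter I U : Filter (I → M)).productSetoid fun _ => M) f

theorem germ_eq_germ {f g : (I → M) → M} :
    germ U f = germ U g ↔ ∀ᶠ x in (productUltrafilter I U : Filter (I → M)), f x = g x :=
  Quotient.eq''

theorem realize_germ {n : ℕ} {β : Type*} (φ : L.BoundedFormula β n) (f : β → (I → M) → M)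
    (g : Fin n → (I → M) → M) :
    φ.Realize (fun i => germ U (f i)) (fun i => germ U (g i)) ↔
      ∀ᶠ x in (productUltrafilter I U : Filter (I → M)),
        φ.Realize (fun i => f i x) (fun i => g i x) :=
  Ultraproduct.boundedFormula_realize_cast φ f g

theorem funMap_germ {n : ℕ} (F : L.Functions n) (f : Fin n → (I → M) → M) :
    Structure.funMap F (fun i => germ U (f i)) =
      germ U fun x => Structure.funMap F fun i => f i x :=
  Ultraproduct.funMap_cast F f

theorem relMap_germ {n : ℕ} (R : L.Relations n) (f : Fin n → (I → M) → M) :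
    Structure.RelMap R (fun i => germ U (f i)) ↔
      ∀ᶠ x in (productUltrafilter I U : Filter (I → M)), Structure.RelMap R fun i => f i x :=
  relMap_quotient_mk' (s := (productUltrafilter I U : Filter (I → M)).productSetoid fun _ => M) R f

theorem FiniteSupport.eventually_comp_orderIso {P : (I → M) → Prop} (hP : FiniteSupport P)
    (τ : I ≃o I) :
    (∀ᶠ x in (productUltrafilter I U : Filter (I → M)), P (x ∘ τ)) ↔
      ∀ᶠ x in (productUltrafilter I U : Filter (I → M)), P x :=
  hP.elim fun _ hs => IteratedUltrafilter.eventually_comp_orderIso U hs τ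

variable (L I) in
/-- The substructure of the ultrapower of classes of functions of finite support. -/
noncomputable def finitePowerSubstructure : L.Substructure (Power I U) where
  carrier := {q | ∃ f, FiniteSupport f ∧ germ U f = q}
  fun_mem F q hq := by
    choose f hf hfq using hq
    obtain rfl : (fun i => germ U (f i)) = q := funext hfq
    exact ⟨_, FiniteSupport.comp_tuple hf (Structure.funMap F), (funMap_germ U F f).symm⟩

variable (L I) in
/-- The iterated ultrapower of `M` along `I`, as an elementary substructure. -/
noncomputable def finitePower : L.ElementarySubstructure (Power I U) :=
  (finitePowerSubstructure L I U).toElementarySubstructure <| by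
    intro n φ q a h
    choose f hf hfq using fun i => (q i).2
    obtain ⟨a, rfl⟩ : ∃ g, germ U g = a := Quotient.exists_rep a
    have hv : (Subtype.val ∘ q) = fun i => germ U (f i) := funext fun i => (hfq i).symm
    have hsnoc : ∀ b : (I → M) → M, (Fin.snoc (fun i => germ U (f i)) (germ U b) : Fin (n + 1) → _)
        = fun i => germ U ((Fin.snoc f b : Fin (n + 1) → (I → M) → M) i) := fun b =>
      (Fin.comp_snoc (germ U) f b).symm
    have hsnoc' : ∀ (b : (I → M) → M) (x : I → M),
        (fun i => (Fin.snoc f b : Fin (n + 1) → (I → M) → M) i x) =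
          (Fin.snoc (fun i => f i x) (b x) : Fin (n + 1) → M) := fun b x =>
      Fin.comp_snoc (fun g : (I → M) → M => g x) f b
    have hdef : (default : Empty → Power I U) = fun e => germ U (e.elim : (I → M) → M) :=
      Subsingleton.elim _ _
    -- Tarski–Vaught: a Skolem function applied to the parameters depends only on their common
    -- finite support, unlike the given witness.
    let w : (Fin n → M) → M := fun c =>
      Classical.epsilon fun m => φ.Realize (default : Empty → M) (Fin.snoc c m)
    refine ⟨⟨germ U fun x => w fun i => f i x, _, FiniteSupport.comp_tuple hf w, rfl⟩, ?_⟩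
    rw [hv, hdef] at h ⊢
    rw [hsnoc, realize_germ] at h ⊢
    refine h.mono fun x hx => ?_
    rw [hsnoc'] at hx ⊢
    rw [Subsingleton.elim (fun i : Empty => _) (default : Empty → M)] at hx ⊢
    exact Classical.epsilon_spec (p := fun m => φ.Realize default (Fin.snoc _ m)) ⟨_, hx⟩

variable (L) in
/-- The element of the iterated ultrapower represented by a function of finite support. -/
noncomputable def finiteGerm (f : (I → M) → M) (hf : FiniteSupport f) : finitePower L I U :=
  ⟨germ U f, f, hf, rfl⟩

theorem finiteGerm_surjective (q : finitePower L I U) :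
    ∃ f, ∃ hf : FiniteSupport f, finiteGerm L U f hf = q := by
  obtain ⟨_, f, hf, rfl⟩ := q
  exact ⟨f, hf, rfl⟩

theorem finiteGerm_eq {f g : (I → M) → M} {hf : FiniteSupport f} {hg : FiniteSupport g} :
    finiteGerm L U f hf = finiteGerm L U g hg ↔
      ∀ᶠ x in (productUltrafilter I U : Filter (I → M)), f x = g x :=
  Subtype.ext_iff.trans (germ_eq_germ U)

/-- Makes the shift independent of representatives; finite support is what gives invariance under
`τ`. -/
theorem finiteGerm_comp_eq (τ : I ≃o I) {f g : (I → M) → M} {hf : FiniteSupport f}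
    {hg : FiniteSupport g} :
    finiteGerm L U (fun x => f (x ∘ τ)) (hf.comp_orderIso τ) =
        finiteGerm L U (fun x => g (x ∘ τ)) (hg.comp_orderIso τ) ↔
      finiteGerm L U f hf = finiteGerm L U g hg := by
  rw [finiteGerm_eq, finiteGerm_eq]
  refine FiniteSupport.eventually_comp_orderIso U (P := fun x => f x = g x) ?_ τ
  exact FiniteSupport.comp_tuple (f := ![f, g]) (Fin.forall_fin_two.2 ⟨hf, hg⟩)
    (fun c => c 0 = c 1)

variable (L) in
/-- Translation of the coordinates, as a map of the iterated ultrapower. -/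
noncomputable def shiftFun (τ : I ≃o I) (q : finitePower L I U) : finitePower L I U :=
  finiteGerm L U (fun x => (finiteGerm_surjective U q).choose (x ∘ τ))
    ((finiteGerm_surjective U q).choose_spec.choose.comp_orderIso τ)

theorem shiftFun_finiteGerm (τ : I ≃o I) (f : (I → M) → M) (hf : FiniteSupport f) :
    shiftFun L U τ (finiteGerm L U f hf) =
      finiteGerm L U (fun x => f (x ∘ τ)) (hf.comp_orderIso τ) :=
  (finiteGerm_comp_eq U τ).2 (finiteGerm_surjective U (finiteGerm L U f hf)).choose_spec.choose_spec

theorem shiftFun_symm (τ : I ≃o I) (q : finitePower L I U) :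
    shiftFun L U τ (shiftFun L U τ.symm q) = q := by
  obtain ⟨f, hf, rfl⟩ := finiteGerm_surjective U q
  rw [shiftFun_finiteGerm, shiftFun_finiteGerm, finiteGerm_eq]
  exact Eventually.of_forall fun x => congrArg f (funext fun i => congrArg x (by simp))

variable (L) in
/-- Translation of the coordinates, as an automorphism of the iterated ultrapower. -/
noncomputable def shift (τ : I ≃o I) : finitePower L I U ≃[L] finitePower L I U where
  toFun := shiftFun L U τ
  invFun := shiftFun L U τ.symm
  left_inv q := shiftFun_symm U τ.symm q
  right_inv q := shiftFun_symm U τ q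
  map_fun' {n} F q := by
    choose f hf hfq using fun i => finiteGerm_surjective U (q i)
    obtain rfl : (fun i => finiteGerm L U (f i) (hf i)) = q := funext hfq
    have hF : ∀ (g : Fin n → (I → M) → M) (hg : ∀ i, FiniteSupport (g i)),
        Structure.funMap F (fun i => finiteGerm L U (g i) (hg i)) =
          finiteGerm L U (fun x => Structure.funMap F fun i => g i x)
            (FiniteSupport.comp_tuple hg (Structure.funMap F)) := fun g hg =>
      Subtype.ext (funMap_germ U F g)
    simp only [comp_def, shiftFun_finiteGerm, hF]
  map_rel' {n} R q := by
    choose f hf hfq using fun i => finiteGerm_surjective U (q i)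
    obtain rfl : (fun i => finiteGerm L U (f i) (hf i)) = q := funext hfq
    have hR : ∀ (g : Fin n → (I → M) → M) (hg : ∀ i, FiniteSupport (g i)),
        Structure.RelMap R (fun i => finiteGerm L U (g i) (hg i)) ↔
          ∀ᶠ x in (productUltrafilter I U : Filter (I → M)), Structure.RelMap R fun i => g i x :=
      fun g hg => relMap_germ U R g
    simp only [comp_def, shiftFun_finiteGerm, hR]
    exact FiniteSupport.eventually_comp_orderIso U
      (FiniteSupport.comp_tuple hf (Structure.RelMap R)) τ

theorem shift_finiteGerm (τ : I ≃o I) (f : (I → M) → M) (hf : FiniteSupport f) :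
    shift L U τ (finiteGerm L U f hf) =
      finiteGerm L U (fun x => f (x ∘ τ)) (hf.comp_orderIso τ) :=
  shiftFun_finiteGerm U τ f hf

theorem iterate_shift_finiteGerm (τ : I ≃o I) (n : ℕ) (f : (I → M) → M) (hf : FiniteSupport f) :
    (shift L U τ)^[n] (finiteGerm L U f hf) =
      finiteGerm L U (fun x => f (x ∘ ⇑(τ ^ n))) (hf.comp_orderIso (τ ^ n)) := by
  induction n generalizing f with
  | zero => rfl
  | succ n ih =>
    rw [iterate_succ_apply, shift_finiteGerm, ih, finiteGerm_eq]
    refine Eventually.of_forall fun x => congrArg f (funext fun i => congrArg x ?_)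
    rw [pow_succ]
    rfl

theorem realize_finiteGerm (φ : L.Formula (Fin 1)) (f : (I → M) → M) (hf : FiniteSupport f) :
    φ.Realize (fun _ => finiteGerm L U f hf) ↔
      ∀ᶠ x in (productUltrafilter I U : Filter (I → M)), φ.Realize fun _ => f x := by
  rw [← (finitePower L I U).subtype.map_formula φ]
  exact Ultraproduct.realize_formula_cast φ fun _ => f

/-- The constant class of an algebraic element is algebraic. -/
theorem isAlgebraicElement_finiteGerm {b : M} (hb : AlgModel.IsAlgebraicElement L b)
    {f : (I → M) → M} (hf : FiniteSupport f)
    (hfb : ∀ᶠ x in (productUltrafilter I U : Filter (I → M)), f x = b) :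
    AlgModel.IsAlgebraicElement L (finiteGerm L U f hf) := by
  obtain ⟨φ, hfin, hφ⟩ := hb
  have hc : ∀ c : M, FiniteSupport fun _ : I → M => c := fun c => ⟨∅, fun _ _ _ => rfl⟩
  refine ⟨φ, (hfin.image fun c => finiteGerm L U (fun _ => c) (hc c)).subset ?_, ?_⟩
  · intro q hq
    obtain ⟨g, hg, rfl⟩ := finiteGerm_surjective U q
    have hq' : ∀ᶠ x in (productUltrafilter I U : Filter (I → M)),
        ∃ c ∈ {c : M | φ.Realize fun _ => c}, g x = c :=
      ((realize_finiteGerm U φ g hg).1 hq).mono fun x hx => ⟨g x, hx, rfl⟩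
    -- An ultrafilter selects one case of a finite disjunction, so every solution of `φ` is a
    -- constant class.
    obtain ⟨c, hcφ, hc'⟩ := (Ultrafilter.eventually_exists_mem_iff hfin).1 hq'
    exact ⟨c, hcφ, ((finiteGerm_eq U).2 hc').symm⟩
  · rw [realize_finiteGerm]
    exact hfb.mono fun x hx => hx ▸ hφ

end IteratedUltrafilter

/-! ### Invariant elementary substructures and transfer of algebraicity. -/

namespace AlgModel

open FirstOrder.Language

/-- Function symbols for an automorphism and its inverse. -/
inductive AutFunctions : ℕ → Type
  | fwd : AutFunctions 1
  | bwd : AutFunctions 1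

/-- The language of an automorphism and its inverse. -/
def autLanguage : FirstOrder.Language.{0, 0} := ⟨AutFunctions, fun _ => Empty⟩

theorem card_autLanguage_le : autLanguage.card ≤ ℵ₀ := by
  have h₁ : Countable (Σ n, autLanguage.Functions n) := by
    refine Function.Surjective.countable
      (f := fun b : Bool => if b then (⟨1, .fwd⟩ : Σ n, AutFunctions n) else ⟨1, .bwd⟩) ?_
    rintro ⟨_, _ | _⟩
    exacts [⟨true, rfl⟩, ⟨false, rfl⟩]
  have h₂ : IsEmpty (Σ n, autLanguage.Relations n) := ⟨fun p => p.2.elim⟩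
  exact Cardinal.mk_le_aleph0_iff.2 (inferInstanceAs (Countable (_ ⊕ _)))

variable {L : FirstOrder.Language.{u, v}} {N : Type x} [L.Structure N]

/-- The expansion of a structure by an automorphism and its inverse. -/
@[reducible]
def autStructure (σ : N ≃[L] N) : autLanguage.Structure N where
  funMap F y := match F, y with
    | .fwd, y => σ (y 0)
    | .bwd, y => σ.symm (y 0)
  RelMap R _ := R.elim

/-- The reduct of an elementary substructure is elementary. -/
theorem isElementary_substructureReduct {L' : FirstOrder.Language} [L'.Structure N] (ψ : L →ᴸ L')
    [ψ.IsExpansionOn N] (S : L'.ElementarySubstructure N) :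
    (ψ.substructureReduct S.toSubstructure).IsElementary := by
  let S₀ := ψ.substructureReduct S.toSubstructure
  let : L'.Structure S₀ := Substructure.inducedStructure (S := S.toSubstructure)
  have hexp : ψ.IsExpansionOn S₀ :=
    { map_onFunction := fun F y => Subtype.ext (ψ.map_onFunction F fun i => (y i : N))
      map_onRelation := fun R y => ψ.map_onRelation R fun i => (y i : N) }
  intro n φ y
  have h := S.isElementary' (ψ.onFormula φ) y
  rw [LHom.realize_onFormula] at h
  exact h.trans (LHom.realize_onFormula (M := S₀) ψ φ)

/-- A downward Löwenheim–Skolem theorem for structures with an automorphism. -/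
theorem exists_elementarySubstructure_invariant (σ : N ≃[L] N) (s : Set N) (κ : Cardinal.{w})
    (hω : ℵ₀ ≤ κ) (hs : Cardinal.lift.{w} #s ≤ Cardinal.lift.{x} κ)
    (hL : Cardinal.lift.{w} L.card ≤ Cardinal.lift.{max u v} κ)
    (hN : Cardinal.lift.{x} κ ≤ Cardinal.lift.{w} #N) :
    ∃ S : L.ElementarySubstructure N, s ⊆ S ∧ Cardinal.lift.{w} #S = Cardinal.lift.{x} κ ∧
      (∀ y ∈ S, σ y ∈ S) ∧ ∀ y ∈ S, σ.symm y ∈ S := by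
  let := autStructure σ
  have hcard : Cardinal.lift.{w} (L.sum autLanguage).card ≤ Cardinal.lift.{max u v} κ := by
    rw [card_sum, Cardinal.lift_add]
    refine Cardinal.add_le_of_le (by simpa using hω) ?_ ?_
    · simpa using hL
    · have h : Cardinal.lift.{max (max u v) w} autLanguage.card ≤ ℵ₀ := by
        simpa using card_autLanguage_le
      refine le_trans ?_ (h.trans (by simpa using hω))
      simp
  obtain ⟨S, hsS, hSκ⟩ := exists_elementarySubstructure_card_eq (L.sum autLanguage) s κ hω hs hcard hN
  refine ⟨⟨_, isElementary_substructureReduct LHom.sumInl S⟩, hsS, hSκ, fun y hy => ?_,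
    fun y hy => ?_⟩
  · exact S.toSubstructure.fun_mem (n := 1) (Sum.inr AutFunctions.fwd) (fun _ => y) fun _ => hy
  · exact S.toSubstructure.fun_mem (n := 1) (Sum.inr AutFunctions.bwd) (fun _ => y) fun _ => hy

/-- The restriction of an automorphism to an invariant elementary substructure. -/
def restrictAut (σ : N ≃[L] N) (S : L.ElementarySubstructure N) (h : ∀ y ∈ S, σ y ∈ S)
    (h' : ∀ y ∈ S, σ.symm y ∈ S) : S ≃[L] S where
  toFun y := ⟨σ y, h y y.2⟩
  invFun y := ⟨σ.symm y, h' y y.2⟩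
  left_inv _ := Subtype.ext (σ.symm_apply_apply _)
  right_inv _ := Subtype.ext (σ.apply_symm_apply _)
  map_fun' F y := Subtype.ext (σ.map_fun F fun i => (y i : N))
  map_rel' R y := σ.map_rel R fun i => (y i : N)

theorem coe_iterate_restrictAut (σ : N ≃[L] N) (S : L.ElementarySubstructure N)
    (h : ∀ y ∈ S, σ y ∈ S) (h' : ∀ y ∈ S, σ.symm y ∈ S) (n : ℕ) (y : S) :
    ((restrictAut σ S h h')^[n] y : N) = σ^[n] y :=
  (Function.Semiconj.iterate_right (f := Subtype.val) (ga := restrictAut σ S h h') (gb := σ)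
    (fun _ => rfl) n) y

theorem IsAlgebraicElement.of_elementarySubstructure {S : L.ElementarySubstructure N} {y : S}
    (h : IsAlgebraicElement L (y : N)) : IsAlgebraicElement L y := by
  obtain ⟨φ, hfin, hφ⟩ := h
  have hS : ∀ z : S, φ.Realize (fun _ => (z : N)) ↔ φ.Realize fun _ => z := fun z =>
    S.subtype.map_formula φ fun _ => z
  refine ⟨φ, (hfin.preimage Subtype.val_injective.injOn).subset fun z hz => ?_, (hS y).1 hφ⟩
  exact (hS z).2 hz

theorem IsAlgebraicElement.map_equiv {N' : Type*} [L.Structure N'] (e : N ≃[L] N') {y : N}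
    (h : IsAlgebraicElement L y) : IsAlgebraicElement L (e y) := by
  obtain ⟨φ, hfin, hφ⟩ := h
  have he : ∀ z : N, φ.Realize (fun _ => e z) ↔ φ.Realize fun _ => z := fun z =>
    StrongHomClass.realize_formula e φ (v := fun _ => z)
  refine ⟨φ, (hfin.image e).subset fun z hz => ?_, (he y).2 hφ⟩
  refine ⟨e.symm z, (he _).1 ?_, e.apply_symm_apply z⟩
  simpa using hz

/-- An element with infinite orbit under an automorphism is nonalgebraic. -/
theorem not_isAlgebraicElement_of_iterate_ne (σ : N ≃[L] N) {y : N}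
    (h : ∀ n, 1 ≤ n → σ^[n] y ≠ y) : ¬ IsAlgebraicElement L y := by
  rintro ⟨φ, hfin, hφ⟩
  have horb : ∀ n, φ.Realize fun _ => σ^[n] y := by
    intro n
    induction n with
    | zero => exact hφ
    | succ n ih =>
      rw [Function.iterate_succ_apply']
      exact (StrongHomClass.realize_formula σ φ (v := fun _ => σ^[n] y)).2 ih
  obtain ⟨m, n, hmn, heq⟩ := hfin.exists_lt_map_eq_of_forall_mem horb
  refine h (n - m) (by omega) (σ.injective.iterate m ?_)
  rw [← Function.iterate_add_apply, Nat.add_sub_cancel' hmn.le]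
  exact heq.symm

end AlgModel

/-! ### The index order `ℤ ×ₗ ι` and fixed points of the shift. -/

namespace IteratedUltrafilter

open Filter Function FirstOrder.Language

/-- Translation of the first coordinate by `1`. -/
noncomputable def lexSucc (ι : Type w) [LinearOrder ι] : (ℤ ×ₗ ι) ≃o (ℤ ×ₗ ι) :=
  Prod.Lex.prodLexCongr (OrderIso.addRight 1) (OrderIso.refl ι)

theorem lexSucc_pow_apply {ι : Type w} [LinearOrder ι] (n : ℕ) (i : ℤ ×ₗ ι) :
    (lexSucc ι ^ n) i = toLex ((ofLex i).1 + n, (ofLex i).2) := by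
  induction n with
  | zero => simp
  | succ n ih =>
    rw [pow_succ']
    change lexSucc ι ((lexSucc ι ^ n) i) = _
    rw [ih]
    change toLex ((ofLex i).1 + n + 1, (ofLex i).2) = _
    push_cast
    rw [add_assoc]

theorem exists_lt_lexSucc_pow {ι : Type w} [LinearOrder ι] (s : Finset (ℤ ×ₗ ι)) :
    ∃ k : ℕ, ∀ n, k ≤ n → ∀ i ∈ s, ∀ j ∈ s, i < (lexSucc ι ^ n) j := by
  -- Twice the sum of the absolute values bounds the difference of any two first coordinates.
  refine ⟨s.sum (fun i => ((ofLex i).1.natAbs)) * 2 + 1, fun n hn i hi j hj => ?_⟩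
  have hi' := Finset.single_le_sum (f := fun i : ℤ ×ₗ ι => (ofLex i).1.natAbs)
    (fun _ _ => Nat.zero_le _) hi
  have hj' := Finset.single_le_sum (f := fun i : ℤ ×ₗ ι => (ofLex i).1.natAbs)
    (fun _ _ => Nat.zero_le _) hj
  rw [lexSucc_pow_apply, Prod.Lex.lt_iff]
  left
  change (ofLex i).1 < (ofLex j).1 + n
  omega

variable {L : FirstOrder.Language.{u, v}} {M : Type w'} [L.Structure M] [Nonempty M]
  {U : Ultrafilter M} {ι : Type w} [LinearOrder ι]

theorem isAlgebraicElement_of_iterate_shift_eq (hM : AlgModel.IsAlgebraicStructure L M)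
    {n : ℕ} (hn : 1 ≤ n) {q : finitePower L (ℤ ×ₗ ι) U}
    (hq : (shift L U (lexSucc ι))^[n] q = q) : AlgModel.IsAlgebraicElement L q := by
  obtain ⟨f, hf, rfl⟩ := finiteGerm_surjective U q
  obtain ⟨s, hs⟩ := id hf
  obtain ⟨k, hk⟩ := exists_lt_lexSucc_pow s
  -- Pass to the power `n * k ≥ k`, which moves the support past itself.
  have hfix := IsFixedPt.iterate (f := (shift L U (lexSucc ι))^[n]) hq k
  rw [← iterate_mul, IsFixedPt, iterate_shift_finiteGerm, eq_comm, finiteGerm_eq] at hfix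
  obtain ⟨y, hy⟩ := exists_eventually_eq_const U hs _
    (hk (n * k) (Nat.le_mul_of_pos_left k hn)) hfix
  exact isAlgebraicElement_finiteGerm U (hM (f y)) hf hy

variable (L U) in
/-- The element of the iterated ultrapower represented by a coordinate projection. -/
noncomputable def coordinate {I : Type w} [LinearOrder I] (i : I) : finitePower L I U :=
  finiteGerm L U (fun y => y i) (finiteSupport_eval i)

theorem coordinate_injective {I : Type w} [LinearOrder I]
    (hU : ∀ m, ∀ᶠ m' in (U : Filter M), m' ≠ m) :
    Injective (coordinate L U : I → finitePower L I U) := by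
  refine Function.Injective.of_lt_imp_ne fun i j hij h => ?_
  exact Ultrafilter.eventually_not.1 (eventually_ne_of_lt U hU hij) ((finiteGerm_eq U).1 h)

theorem iterate_shift_coordinate_ne (hU : ∀ m, ∀ᶠ m' in (U : Filter M), m' ≠ m) (i : ℤ ×ₗ ι)
    {n : ℕ} (hn : 1 ≤ n) :
    (shift L U (lexSucc ι))^[n] (coordinate L U i) ≠ coordinate L U i := by
  rw [coordinate, iterate_shift_finiteGerm]
  refine fun h => (?_ : (lexSucc ι ^ n) i ≠ i) (coordinate_injective (L := L) hU h)
  rw [lexSucc_pow_apply]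
  intro h
  have := congrArg (fun z => (ofLex z).1) h
  simp at this
  omega

end IteratedUltrafilter

/-! ### Assembly of the model. -/

theorem corollary2p3 (L : FirstOrder.Language.{u, v}) (T : L.Theory)
    (hT : ∃ (M : Type w') (_ : L.Structure M),
      M ⊨ T ∧ Infinite M ∧ AlgModel.IsAlgebraicStructure L M)
    (κ : Cardinal.{w}) (hω : ℵ₀ ≤ κ)
    (hL : Cardinal.lift.{w} L.card ≤ Cardinal.lift.{max u v} κ) :
    ∃ (N : Type w) (_ : L.Structure N),
      N ⊨ T ∧ #N = κ ∧ ¬ AlgModel.IsAlgebraicStructure L N ∧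
        ∃ α : N ≃[L] N, ∀ n : ℕ, 1 ≤ n →
          AlgModel.IsMaximalAutomorphism (AlgModel.iterateAut α n) := by
  obtain ⟨M, _, hMT, hinf, hM⟩ := hT
  let U : Ultrafilter M := Filter.hyperfilter M
  have hU : ∀ m, ∀ᶠ m' in (U : Filter M), m' ≠ m := fun m =>
    Filter.hyperfilter_le_cofinite (Set.finite_singleton m).compl_mem_cofinite
  let ι : Type w := κ.ord.ToType
  have hι : #ι = κ := Cardinal.mk_ord_toType κ
  have hιne : Nonempty ι := Cardinal.mk_ne_zero_iff.1 (hι ▸ (Cardinal.aleph0_pos.trans_le hω).ne')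
  let P := IteratedUltrafilter.finitePower L (ℤ ×ₗ ι) U
  let σ : P ≃[L] P := IteratedUltrafilter.shift L U (IteratedUltrafilter.lexSucc ι)
  let i₀ : ℤ ×ₗ ι := toLex (0, Classical.arbitrary ι)
  have hP : P ⊨ T := by
    refine ⟨fun φ hφ => ?_⟩
    rw [FirstOrder.Language.ElementarySubstructure.realize_sentence,
      FirstOrder.Language.Ultraproduct.sentence_realize]
    exact Filter.Eventually.of_forall fun _ => T.realize_sentence_of_mem hφ
  have hPκ : Cardinal.lift.{max w w'} κ ≤ Cardinal.lift.{w} #P := by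
    have hinj : Function.Injective
        fun a : ι => IteratedUltrafilter.coordinate L U (toLex ((0 : ℤ), a)) :=
      (IteratedUltrafilter.coordinate_injective hU).comp fun a b h => congrArg (fun z => (ofLex z).2) h
    refine (congrArg Cardinal.lift hι).symm.trans_le ?_
    exact Cardinal.lift_mk_le_lift_mk_of_injective hinj
  -- Seeding with a coordinate keeps an element of infinite orbit in `S`.
  obtain ⟨S, hsS, hSκ, hσ, hσ'⟩ := AlgModel.exists_elementarySubstructure_invariant σ
    {IteratedUltrafilter.coordinate L U i₀} κ hω
    (by simpa using Cardinal.one_le_aleph0.trans hω) hL hPκ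
  let τ : S ≃[L] S := AlgModel.restrictAut σ S hσ hσ'
  -- Transport to `κ.out` puts the model in the universe of `κ`.
  obtain ⟨e⟩ : Nonempty (S ≃ κ.out) := by
    refine Cardinal.lift_mk_eq'.1 ?_
    rw [Cardinal.mk_out, hSκ]
  let : L.Structure κ.out := e.inducedStructure
  let E : S ≃[L] κ.out := e.inducedStructureEquiv
  let α : κ.out ≃[L] κ.out := E.comp (τ.comp E.symm)
  have hα : ∀ n (y : S), α^[n] (E y) = E (τ^[n] y) := fun n y =>
    ((Function.Semiconj.iterate_right (f := E) (ga := τ) (gb := α)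
      (fun z => by simp [α]) n) y).symm
  have hτ : ∀ n, 1 ≤ n → ∀ y : S, τ^[n] y = y → AlgModel.IsAlgebraicElement L y := by
    intro n hn y hy
    refine AlgModel.IsAlgebraicElement.of_elementarySubstructure
      (IteratedUltrafilter.isAlgebraicElement_of_iterate_shift_eq hM hn ?_)
    rw [← AlgModel.coe_iterate_restrictAut σ S hσ hσ' n y]
    exact congrArg Subtype.val hy
  refine ⟨κ.out, inferInstance, ?_, κ.mk_out, ?_, α, fun n hn y hy => ?_⟩
  · have : S ⊨ T := (S.theory_model_iff T).2 hP
    exact FirstOrder.Language.StrongHomClass.theory_model E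
  · intro halg
    refine AlgModel.not_isAlgebraicElement_of_iterate_ne τ
      (y := ⟨_, hsS (Set.mem_singleton _)⟩) (fun n hn h => ?_) ?_
    · refine IteratedUltrafilter.iterate_shift_coordinate_ne (L := L) hU i₀ hn ?_
      have h' := congrArg Subtype.val h
      rwa [AlgModel.coe_iterate_restrictAut] at h'
    · simpa using (halg (E _)).map_equiv E.symm
  · rw [AlgModel.coe_iterateAut]
    intro hfix
    apply hy
    obtain ⟨z, rfl⟩ := E.surjective y
    rw [hα] at hfix
    exact (hτ n hn z (E.injective hfix)).map_equiv E
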